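/- Let $n\ge 13$. Let $P(n,3)$ be the generalized Petersen graph with vertex set $\{u_j,v_j : j\in\mathbb{Z}_n\}$ and edges $$e_j^u=u_ju_{j+1},\qquad e_j^s=u_jv_j,\qquad e_j^v=v_jv_{j+3}\qquad (j\in\mathbb{Z}_n).$$ This graph is connected. The distance between a vertex $x$ and an edge $e=yz$ is $d(x,e)=\min\{d(x,y),d(x,z)\}$, where $d$ on pairs of vertices is the usual graph distance. For an integer $m$ write $m=3q_m+r_m$ with $q_m\in\mathbb{Z}$ and $r_m\in\{0,1,2\}$. Let $0\le i\le n-1$, and put $r=0$ if $(r_n,r_i)=(0,2)$ and $r=|r_n-r_i|$ otherwise. Then $$d(u_0,e_i^u)=\begin{cases}\min(i,\,n-1-i) & \text{if } i\le 2 \text{ or } i\ge n-3,\\ \min(\lceil i/3\rceil+2,\ \lceil (n-i-1)/3\rceil+2) & \text{otherwise;}\end{cases}$$ $$d(u_0,e_i^s)=\begin{cases}\min(i,\,n-i) & \text{if } i\le 2 \text{ or } i\ge n-2,\\ \min(q_i+r_i+1,\ q_n-q_i+r+1) & \text{otherwise;}\end{cases}$$ $$d(u_0,e_i^v)=\begin{cases}\min(i+1,\,n-i+1)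 & \text{if } i\le 1 \text{ or } i=n-1,\\ \min(q_i+r_i+1,\ q_n-q_i+r) & \text{otherwise;}\end{cases}$$ $$d(v_0,e_i^u)=\begin{cases}\min(q_i+\lfloor r_i/2\rfloor+1,\ q_n-q_i+\lfloor r_n/2\rfloor-\lfloor r_i/2\rfloor+1) & \text{if } r_i=0 \text{ or } (r_n,r_i)=(0,2),\\ \min(q_i+2,\ q_n-q_i+1) & \text{otherwise;}\end{cases}$$ $$d(v_0,e_i^s)=\begin{cases}\min(q_i,\ q_n-q_i) & \text{if } r_i=r_n=0,\\ \min(q_i+r_n+1,\ q_n-q_i) & \text{if } r_i=r_n\ne 0,\\ \min(q_i,\ q_n-q_i+r_n+1) & \text{if } r_i=0\ne r_n,\\ \min(q_i+2,\ q_n-q_i+2) & \text{if } r_i=1\ne r_n,\\ \min(q_i+3,\ q_n-q_i+r_n+1) & \text{if } r_i=2\ne r_n;\end{cases}$$ and $d(v_0,e_{n-1}^v)=3$, while for $0\le i\le n-2$ $$d(v_0,e_i^v)=\begin{cases}\min(q_i,\ q_n-q_i-1) & \text{if } r_i=r_n=0,\\ \min(q_i+r_i+2,\ q_n-q_i+r_n-r_i-1)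 & \text{if } r_i=r_n\ne 0,\\ \min(q_i,\ q_n-q_i+r_n+1) & \text{if } r_i=0\ne r_n,\\ \min(q_i+3,\ q_n-q_i+2) & \text{if } r_i=1\ne r_n,\\ \min(q_i+4,\ q_n-q_i+r_n+1) & \text{if } r_i=2\ne r_n.\end{cases}$$ -/

import Mathlib

namespace GenPetersen

/-- The vertices `u_j` (outer) and `v_j` (inner) of `P(n,k)`, with `j` in `ℤ/nℤ`. -/
inductive Vertex (n : ℕ) : Type
  | u : ZMod n → Vertex n
  | v : ZMod n → Vertex n

/-- The outer edge `e_j^u = u_j u_{j+1}`. -/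
def outerEdge (n : ℕ) (j : ZMod n) : Sym2 (Vertex n) := s(Vertex.u j, Vertex.u (j + 1))

/-- The inner edge `v_j v_{j+k}` (for `k = 3` this is `e_j^v`). -/
def innerEdge (n k : ℕ) (j : ZMod n) : Sym2 (Vertex n) := s(Vertex.v j, Vertex.v (j + (k : ZMod n)))

/-- The spoke `e_j^s = u_j v_j`. -/
def spoke (n : ℕ) (j : ZMod n) : Sym2 (Vertex n) := s(Vertex.u j, Vertex.v j)

/-- The generalized Petersen graph `P(n,k)` (for `n ≥ 3` and `1 ≤ k < n/2`). -/
def petersen (n k : ℕ) : SimpleGraph (Vertex n) :=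
  SimpleGraph.fromEdgeSet
    {e | ∃ j : ZMod n, e = outerEdge n j ∨ e = innerEdge n k j ∨ e = spoke n j}

/-- The distance `d(x,e) = min(d(x,a), d(x,b))` from a vertex `x` to an edge `e = ab`. -/
noncomputable def distEdge {V : Type*} (G : SimpleGraph V) (x : V) (e : Sym2 V) : ℕ :=
  Sym2.lift ⟨fun a b => min (G.dist x a) (G.dist x b), fun _ _ => min_comm _ _⟩ e

/-- The integer `q_m` in `m = 3 q_m + r_m`, `r_m ∈ {0,1,2}`. -/
def q (m : ℤ) : ℤ := m / 3

/-- The integer `r_m` in `m = 3 q_m + r_m`, `r_m ∈ {0,1,2}`. -/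
def r (m : ℤ) : ℤ := m % 3

/-- The number `|r_n - r_i|`, except that it is `0` when `(r_n, r_i) = (0, 2)`. -/
def rDiff (n i : ℤ) : ℤ := if r n = 0 ∧ r i = 2 then 0 else |r n - r i|

end GenPetersen

/-!
All distances in `P(n,3)` are first computed between vertices. In the infinite cover of `P(n,3)`,
with index set `ℤ`, a shortest path between two vertices whose indices differ by `k ≥ 0` takes
`⌊k/3⌋` inner steps, adjusts the residue `k % 3` by outer steps and pays for the spokes it crosses;
only between two outer vertices can it be shorter to stay on the outer rim, with `k` steps. This
gives `outerOuter`, `outerInner` and `innerInner`. The distance in `P(n,3)` from a vertex of index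
`0` to one of index `0 ≤ i < n` is the smaller of the values at `i` and `n - i`, one for each way
around the cycle; `n ≥ 13` excludes shortcuts that go all the way around.

That these minima are the distances follows from a general criterion, `dist_eq_of_descent`: a
function on the vertices that vanishes only at the source, changes by at most `1` along each edge,
and decreases along some edge at every other vertex is the distance from the source.
All its conditions reduce to properties of the functions of `k` that are linear arithmetic with
floors and remainders modulo `3`.

An edge is met at one of its ends going one way around and at the other end going the other way,
so its distance is again a minimum of two terms (`min_bothWays_succ`, `min_bothWays_add_three`),
and comparing residues modulo `3` turns these into the stated closed forms.
-/

namespace GenPetersen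

/-! ### A criterion for a function to be the distance from a vertex -/

section Criterion

variable {V : Type*} {G : SimpleGraph V} {s : V} {f : V → ℕ}

theorem exists_walk_of_descent (h0 : ∀ x, f x = 0 → x = s)
    (hdesc : ∀ x, f x ≠ 0 → ∃ y, G.Adj y x ∧ f y + 1 ≤ f x) (x : V) :
    ∃ p : G.Walk s x, p.length ≤ f x := by
  induction hm : f x using Nat.strong_induction_on generalizing x with
  | _ m ih =>
    subst hm
    by_cases hx : f x = 0
    · obtain rfl := h0 x hx
      exact ⟨.nil, Nat.zero_le _⟩
    · obtain ⟨y, hadj, hy⟩ := hdesc x hx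
      obtain ⟨p, hp⟩ := ih (f y) (by omega) y rfl
      exact ⟨p.concat hadj, by rw [SimpleGraph.Walk.length_concat]; omega⟩

theorem le_add_length_of_lipschitz (hlip : ∀ x y, G.Adj x y → f y ≤ f x + 1) {x y : V}
    (p : G.Walk x y) : f y ≤ f x + p.length := by
  induction p with
  | nil => simp
  | cons h p ih =>
    have := hlip _ _ h
    rw [SimpleGraph.Walk.length_cons]
    omega

theorem connected_of_descent (h0 : ∀ x, f x = 0 → x = s)
    (hdesc : ∀ x, f x ≠ 0 → ∃ y, G.Adj y x ∧ f y + 1 ≤ f x) : G.Connected := by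
  have key (x : V) : G.Reachable s x := (exists_walk_of_descent h0 hdesc x).choose.reachable
  exact { preconnected := fun x y => (key x).symm.trans (key y), nonempty := ⟨s⟩ }

/-- The distance from `s` is the only function on the vertices that vanishes exactly at `s`, is
`1`-Lipschitz along edges, and drops by one along some edge wherever it is nonzero. -/
theorem dist_eq_of_descent (hs : f s = 0) (h0 : ∀ x, f x = 0 → x = s)
    (hlip : ∀ x y, G.Adj x y → f y ≤ f x + 1)
    (hdesc : ∀ x, f x ≠ 0 → ∃ y, G.Adj y x ∧ f y + 1 ≤ f x) (x : V) : G.dist s x = f x := by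
  obtain ⟨p, hp⟩ := exists_walk_of_descent h0 hdesc x
  obtain ⟨p', hp'⟩ := p.reachable.exists_walk_length_eq_dist
  have h1 := le_add_length_of_lipschitz hlip p'
  have h2 := SimpleGraph.dist_le p
  omega

end Criterion

/-! ### Adjacency in the generalized Petersen graph -/

theorem adj_outer {n : ℕ} (hn : 2 ≤ n) (k : ℕ) (j : ZMod n) :
    (petersen n k).Adj (.u j) (.u (j + 1)) := by
  have : Fact (1 < n) := ⟨hn⟩
  refine (SimpleGraph.fromEdgeSet_adj _).2 ⟨⟨j, .inl rfl⟩, ?_⟩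
  simp

theorem adj_spoke {n : ℕ} (k : ℕ) (j : ZMod n) : (petersen n k).Adj (.u j) (.v j) :=
  (SimpleGraph.fromEdgeSet_adj _).2 ⟨⟨j, .inr (.inr rfl)⟩, by simp⟩

theorem adj_inner {n k : ℕ} (hk : 0 < k) (hkn : k < n) (j : ZMod n) :
    (petersen n k).Adj (.v j) (.v (j + (k : ZMod n))) := by
  refine (SimpleGraph.fromEdgeSet_adj _).2 ⟨⟨j, .inr (.inl rfl)⟩, ?_⟩
  have : (k : ZMod n) ≠ 0 := fun h =>
    absurd (Nat.le_of_dvd hk ((ZMod.natCast_eq_zero_iff k n).1 h)) (by omega)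
  simpa using this

theorem lipschitz_of_edges {n k : ℕ} {f : Vertex n → ℕ}
    (ho : ∀ j, f (.u (j + 1)) ≤ f (.u j) + 1 ∧ f (.u j) ≤ f (.u (j + 1)) + 1)
    (hi : ∀ j, f (.v (j + (k : ZMod n))) ≤ f (.v j) + 1 ∧ f (.v j) ≤ f (.v (j + (k : ZMod n))) + 1)
    (hs : ∀ j, f (.v j) ≤ f (.u j) + 1 ∧ f (.u j) ≤ f (.v j) + 1) (x y : Vertex n)
    (h : (petersen n k).Adj x y) : f y ≤ f x + 1 := by
  obtain ⟨⟨j, h | h | h⟩, -⟩ := (SimpleGraph.fromEdgeSet_adj _).1 h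
  · obtain ⟨rfl, rfl⟩ | ⟨rfl, rfl⟩ := Sym2.eq_iff.1 h
    exacts [(ho j).1, (ho j).2]
  · obtain ⟨rfl, rfl⟩ | ⟨rfl, rfl⟩ := Sym2.eq_iff.1 h
    exacts [(hi j).1, (hi j).2]
  · obtain ⟨rfl, rfl⟩ | ⟨rfl, rfl⟩ := Sym2.eq_iff.1 h
    exacts [(hs j).1, (hs j).2]

/-- The representative of `j + c` in `[0, n)` is that of `j`, shifted by `c` with at most one
wrap-around. -/
theorem val_add_cases {n c : ℕ} (hc : c < n) (j : ZMod n) :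
    (j + (c : ZMod n)).val = j.val + c ∧ j.val + c < n ∨
      (j + (c : ZMod n)).val + n = j.val + c := by
  have : NeZero n := ⟨by omega⟩
  have hj := ZMod.val_lt j
  rw [ZMod.val_add, ZMod.val_natCast, Nat.mod_eq_of_lt hc]
  rcases lt_or_ge (j.val + c) n with h | h
  · exact .inl ⟨Nat.mod_eq_of_lt h, h⟩
  · right
    rw [Nat.mod_eq_sub_mod h, Nat.mod_eq_of_lt (by omega)]
    omega

/-! ### Functions of the index difference -/

/-- The better of the two ways around a cycle of length `n`. -/
def bothWays (n : ℕ) (D : ℕ → ℕ) (i : ℕ) : ℕ := min (D i) (D (n - i))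

/-- The function on the vertices of `P(n,k)` that takes the smaller value for the two ways around
the cycle from index `0`, measured by `A` on outer and by `B` on inner vertices. -/
def aroundCycle (n : ℕ) (A B : ℕ → ℕ) : Vertex n → ℕ
  | .u j => bothWays n A j.val
  | .v j => bothWays n B j.val

/-- The criterion `dist_eq_of_descent` for `aroundCycle n A B` on `P(n,3)`, with conditions on the
functions `A` and `B` of the index difference. Where the indices wrap around, inner steps lead
from difference `t ≤ 3` on one side to difference `3 - t` on the other; by `hfar` the long
way around can be ignored there, which is where `n ≥ 13` enters. -/
theorem connected_and_dist_eq {n : ℕ} (hn : 13 ≤ n) {s : Vertex n} {A B : ℕ → ℕ}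
    (hs : aroundCycle n A B s = 0)
    (hA0 : ∀ k, A k = 0 → k = 0 ∧ s = .u 0) (hB0 : ∀ k, B k = 0 → k = 0 ∧ s = .v 0)
    (hA : ∀ k, A (k + 1) ≤ A k + 1 ∧ A k ≤ A (k + 1) + 1) (hAmin : ∀ k, A 0 ≤ A k)
    (hB : ∀ k, B (k + 3) = B k + 1) (hB12 : B 2 ≤ B 1 + 1 ∧ B 1 ≤ B 2 + 1)
    (hfar : ∀ t k, t ≤ 3 → 10 ≤ k → B t ≤ B k)
    (hAB : ∀ k, B k ≤ A k + 1 ∧ A k ≤ B k + 1)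
    (hdA : ∀ k, A k ≠ 0 →
      k ≠ 0 ∧ A (k - 1) + 1 ≤ A k ∨ A (k + 1) + 1 ≤ A k ∨ B k + 1 ≤ A k)
    (hdB : ∀ k, B k ≠ 0 → 3 ≤ k ∧ B (k - 3) + 1 ≤ B k ∨ A k + 1 ≤ B k) :
    (petersen n 3).Connected ∧ ∀ x, (petersen n 3).dist s x = aroundCycle n A B x := by
  have : NeZero n := ⟨by omega⟩
  have hlt := fun j : ZMod n => ZMod.val_lt j
  have h1 (j : ZMod n) := val_add_cases (n := n) (c := 1) (by omega) j
  have h3 (j : ZMod n) := val_add_cases (n := n) (c := 3) (by omega) j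
  simp only [Nat.cast_one] at h1
  have h0 (x : Vertex n) (hx : aroundCycle n A B x = 0) : x = s := by
    cases x with
    | u j =>
      have hj := hlt j
      simp only [aroundCycle, bothWays] at hx
      rcases Nat.min_eq_zero_iff.1 hx with h | h
      · obtain ⟨hv, rfl⟩ := hA0 _ h
        rw [(ZMod.val_eq_zero j).1 hv]
      · have := (hA0 _ h).1
        omega
    | v j =>
      have hj := hlt j
      simp only [aroundCycle, bothWays] at hx
      rcases Nat.min_eq_zero_iff.1 hx with h | h
      · obtain ⟨hv, rfl⟩ := hB0 _ h
        rw [(ZMod.val_eq_zero j).1 hv]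
      · have := (hB0 _ h).1
        omega
  have hlip : ∀ x y, (petersen n 3).Adj x y →
      aroundCycle n A B y ≤ aroundCycle n A B x + 1 := by
    apply lipschitz_of_edges
    · intro j
      have hj := hlt j
      simp only [aroundCycle, bothWays]
      rcases h1 j with ⟨e, h⟩ | e
      · have a1 := hA j.val
        have a2 := hA (n - (j.val + 1))
        rw [show n - (j.val + 1) + 1 = n - j.val by omega] at a2
        rw [e]
        omega
      · have hj' := hlt (j + 1)
        rw [show (j + 1).val = 0 by omega, show j.val = n - 1 by omega,
          show n - (n - 1) = 1 by omega, Nat.sub_zero]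
        have a1 := hA 0
        rw [Nat.zero_add] at a1
        have a2 := hA (n - 1)
        rw [Nat.sub_add_cancel (by omega)] at a2
        omega
    · intro j
      have hj := hlt j
      simp only [aroundCycle, bothWays]
      rcases h3 j with ⟨e, h⟩ | e
      · have a1 := hB j.val
        have a2 := hB (n - (j.val + 3))
        rw [show n - (j.val + 3) + 3 = n - j.val by omega] at a2
        rw [e]
        omega
      · have hj' := hlt (j + (3 : ℕ))
        obtain ⟨t, ht0, ht3, ht⟩ : ∃ t, 1 ≤ t ∧ t ≤ 3 ∧ j.val = n - t :=
          ⟨n - j.val, by omega, by omega, by omega⟩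
        rw [show (j + (3 : ℕ)).val = 3 - t by omega, ht, show n - (n - t) = t by omega]
        have a1 := hfar t (n - t) ht3 (by omega)
        have a2 := hfar (3 - t) (n - (3 - t)) (by omega) (by omega)
        have a3 := hB 0
        simp only [Nat.zero_add] at a3
        rw [min_eq_right a1, min_eq_left a2]
        interval_cases t <;> simp only [Nat.reduceSub] <;> omega
    · intro j
      have a1 := hAB j.val
      have a2 := hAB (n - j.val)
      simp only [aroundCycle, bothWays]
      omega
  have hdesc (x : Vertex n) (hx : aroundCycle n A B x ≠ 0) :
      ∃ y, (petersen n 3).Adj y x ∧ aroundCycle n A B y + 1 ≤ aroundCycle n A B x := by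
    cases x with
    | u j =>
      obtain ⟨l, rfl⟩ : ∃ l : ZMod n, l + 1 = j := ⟨j - 1, sub_add_cancel j 1⟩
      have hprev := adj_outer (by omega) 3 l
      have hnext := (adj_outer (by omega) 3 (l + 1)).symm
      have hspoke := (adj_spoke 3 (l + 1)).symm
      have hl := h1 l
      have hm := h1 (l + 1)
      have hli := hlt l
      have hi := hlt (l + 1)
      have hmi := hlt (l + 1 + 1)
      generalize l + 1 + 1 = m at *
      generalize l + 1 = i at *
      simp only [aroundCycle, bothWays] at hx
      -- At index `0` the direct way is never longer, so the long way is only used elsewhere.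
      have hways : A i.val ≤ A (n - i.val) ∨ A (n - i.val) ≤ A i.val ∧ i.val ≠ 0 := by
        by_cases hz : i.val = 0
        · exact .inl (hz ▸ hAmin _)
        · exact (le_total _ _).imp_right fun h => ⟨h, hz⟩
      rcases hways with hle | ⟨hle, hi0⟩
      · rw [min_eq_left hle] at hx
        rcases hdA _ hx with ⟨hk, h⟩ | h | h
        · refine ⟨_, hprev, ?_⟩
          simp only [aroundCycle, bothWays]
          rw [min_eq_left hle, show l.val = i.val - 1 by omega]
          omega
        · refine ⟨_, hnext, ?_⟩
          simp only [aroundCycle, bothWays]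
          rw [min_eq_left hle]
          rcases hm with ⟨e, -⟩ | e
          · rw [e]
            omega
          · rw [show n - m.val = i.val + 1 by omega]
            omega
        · refine ⟨_, hspoke, ?_⟩
          simp only [aroundCycle, bothWays]
          omega
      · rw [min_eq_right hle] at hx
        rcases hdA _ hx with ⟨hk, h⟩ | h | h
        · refine ⟨_, hnext, ?_⟩
          simp only [aroundCycle, bothWays]
          rw [min_eq_right hle]
          rcases hm with ⟨e, -⟩ | e
          · rw [show n - m.val = n - i.val - 1 by omega]
            omega
          · rw [show m.val = n - i.val - 1 by omega]
            omega
        · refine ⟨_, hprev, ?_⟩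
          simp only [aroundCycle, bothWays]
          rw [min_eq_right hle]
          rw [show n - l.val = n - i.val + 1 by omega]
          omega
        · refine ⟨_, hspoke, ?_⟩
          simp only [aroundCycle, bothWays]
          omega
    | v j =>
      obtain ⟨l, rfl⟩ : ∃ l : ZMod n, l + (3 : ℕ) = j := ⟨j - (3 : ℕ), sub_add_cancel j _⟩
      have hprev := adj_inner (n := n) (k := 3) (by omega) (by omega) l
      have hnext := (adj_inner (n := n) (k := 3) (by omega) (by omega) (l + ((3 : ℕ) : ZMod n))).symm
      have hspoke := adj_spoke 3 (l + ((3 : ℕ) : ZMod n))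
      have hl := h3 l
      have hm := h3 (l + ((3 : ℕ) : ZMod n))
      have hli := hlt l
      have hi := hlt (l + ((3 : ℕ) : ZMod n))
      have hmi := hlt (l + ((3 : ℕ) : ZMod n) + ((3 : ℕ) : ZMod n))
      generalize l + ((3 : ℕ) : ZMod n) + ((3 : ℕ) : ZMod n) = m at *
      generalize l + ((3 : ℕ) : ZMod n) = i at *
      simp only [aroundCycle, bothWays] at hx
      rcases le_total (B i.val) (B (n - i.val)) with hle | hle
      · rw [min_eq_left hle] at hx
        rcases hdB _ hx with ⟨hk, h⟩ | h
        · refine ⟨_, hprev, ?_⟩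
          simp only [aroundCycle, bothWays]
          rw [min_eq_left hle, show l.val = i.val - 3 by omega]
          omega
        · refine ⟨_, hspoke, ?_⟩
          simp only [aroundCycle, bothWays]
          omega
      · rw [min_eq_right hle] at hx
        rcases hdB _ hx with ⟨hk, h⟩ | h
        · refine ⟨_, hnext, ?_⟩
          simp only [aroundCycle, bothWays]
          rw [min_eq_right hle]
          rcases hm with ⟨e, -⟩ | e
          · rw [show n - m.val = n - i.val - 3 by omega]
            omega
          · rw [show m.val = n - i.val - 3 by omega]
            omega
        · refine ⟨_, hspoke, ?_⟩
          simp only [aroundCycle, bothWays]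
          omega
  exact ⟨connected_of_descent h0 hdesc, dist_eq_of_descent hs h0 hlip hdesc⟩

/-! ### Distances between the vertices of `P(n,3)` -/

/-- The distance between two outer vertices with index difference `k` in the infinite cover of
`P(n,3)`: along the rim, or by way of two spokes. -/
def outerOuter (k : ℕ) : ℕ := min k (k / 3 + k % 3 + 2)

/-- The distance between an outer and an inner vertex with index difference `k` in the infinite
cover of `P(n,3)`. -/
def outerInner (k : ℕ) : ℕ := k / 3 + k % 3 + 1

/-- The distance between two inner vertices with index difference `k` in the infinite cover of
`P(n,3)`: the two spokes are needed only if `3 ∤ k`. -/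
def innerInner (k : ℕ) : ℕ := k / 3 + k % 3 + 2 * min (k % 3) 1

theorem connected_and_dist_from_outer {n : ℕ} (hn : 13 ≤ n) :
    (petersen n 3).Connected ∧
      ∀ x, (petersen n 3).dist (.u 0) x = aroundCycle n outerOuter outerInner x := by
  apply connected_and_dist_eq hn
  · simp [aroundCycle, bothWays, outerOuter]
  all_goals simp only [outerOuter, outerInner]
  · exact fun k hk => ⟨by omega, trivial⟩
  all_goals omega

theorem dist_from_inner {n : ℕ} (hn : 13 ≤ n) (x : Vertex n) :
    (petersen n 3).dist (.v 0) x = aroundCycle n outerInner innerInner x := by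
  refine (connected_and_dist_eq hn ?_ ?_ ?_ ?_ ?_ ?_ ?_ ?_ ?_ ?_ ?_).2 x
  · simp [aroundCycle, bothWays, innerInner]
  all_goals simp only [outerInner, innerInner]
  · omega
  · exact fun k hk => ⟨by omega, trivial⟩
  all_goals omega

/-! ### Distances to edges -/

/-- On an edge `{i, i + 1}` of the rim, going one way enters it at difference `i` and going the
other way at difference `n - 1 - i`. -/
theorem min_bothWays_succ {n i i' : ℕ} (hi : i < n)
    (h : i' = i + 1 ∧ i + 1 < n ∨ i' + n = i + 1) (A : ℕ → ℕ) :
    min (bothWays n A i) (bothWays n A i') =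
      min (min (A i) (A (i + 1))) (min (A (n - 1 - i)) (A (n - 1 - i + 1))) := by
  unfold bothWays
  rw [show n - 1 - i + 1 = n - i by omega]
  rcases h with ⟨rfl, h⟩ | h
  · rw [show n - (i + 1) = n - 1 - i by omega]
    omega
  · rw [show i' = 0 by omega, show n - 1 - i = 0 by omega, show i + 1 = n by omega, Nat.sub_zero]
    omega

/-- An inner edge `{i, i + 3}` is reached at its near end going either way, unless it straddles
index `0`; then its ends have differences `1` and `2`. -/
theorem min_bothWays_add_three {n i i' : ℕ} (hn : 13 ≤ n) (hi : i < n)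
    (h : i' = i + 3 ∧ i + 3 < n ∨ i' + n = i + 3) {B : ℕ → ℕ} (hB : ∀ k, B (k + 3) = B k + 1)
    (hfar : ∀ t k, t ≤ 3 → 10 ≤ k → B t ≤ B k) :
    min (bothWays n B i) (bothWays n B i') =
      if i + 3 ≤ n then min (B i) (B (n - 3 - i)) else min (B 1) (B 2) := by
  unfold bothWays
  split_ifs with hin
  · have h1 := hB (n - 3 - i)
    rw [show n - 3 - i + 3 = n - i by omega] at h1
    rcases h with ⟨rfl, h⟩ | h
    · rw [show n - (i + 3) = n - 3 - i by omega, h1, hB]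
      omega
    · have h0 := hfar 0 n (by omega) (by omega)
      have h2 := hfar 0 i (by omega) (by omega)
      rw [show n - 3 - i = 0 by omega] at *
      rw [show i' = 0 by omega, Nat.sub_zero]
      omega
  · have h1 := hfar (n - i) i (by omega) (by omega)
    have h2 := hfar (3 - (n - i)) (n - i') (by omega) (by omega)
    rw [min_eq_right h1, show i' = 3 - (n - i) by omega] at *
    rw [min_eq_left h2]
    obtain h | h : n - i = 1 ∨ n - i = 2 := by omega
    · rw [h]
    · rw [h, min_comm]

theorem min_outerOuter_succ (k : ℕ) :
    min (outerOuter k) (outerOuter (k + 1)) = if k ≤ 2 then k else (k + 2) / 3 + 2 := by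
  unfold outerOuter
  split_ifs <;> omega

theorem min_outerOuter_outerInner (k : ℕ) :
    min (outerOuter k) (outerInner k) = if k ≤ 2 then k else k / 3 + k % 3 + 1 := by
  unfold outerOuter outerInner
  split_ifs <;> omega

theorem min_outerInner_succ (k : ℕ) :
    min (outerInner k) (outerInner (k + 1)) = k / 3 + min (k % 3) 1 + 1 := by
  unfold outerInner
  omega

theorem min_outerInner_innerInner (k : ℕ) :
    min (outerInner k) (innerInner k) = k / 3 + k % 3 + min (k % 3) 1 := by
  unfold outerInner innerInner
  omega

theorem exists_eq_three_mul (m : ℕ) : ∃ c, m = 3 * c ∨ m = 3 * c + 1 ∨ m = 3 * c + 2 :=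
  ⟨m / 3, by omega⟩

/-! ### The floors and ceilings in the closed forms -/

theorem ceil_div_three (a : ℤ) : ⌈(a : ℚ) / 3⌉ = (a + 2) / 3 := by
  have h := Rat.ceil_intCast_div_natCast a 3
  push_cast at h
  omega

theorem floor_div_two (a : ℤ) : ⌊(a : ℚ) / 2⌋ = a / 2 := by
  have h := Rat.floor_intCast_div_natCast a 2
  push_cast at h
  exact h

end GenPetersen

set_option maxHeartbeats 4000000 in
theorem theorem2 (n : ℕ) (hn : 13 ≤ n) :
    (GenPetersen.petersen n 3).Connected ∧
    ∀ i : ℤ, 0 ≤ i → i ≤ (n : ℤ) - 1 →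
      -- the distance from `u_0` to the outer edge `u_i u_{i+1}`
      ((GenPetersen.distEdge (GenPetersen.petersen n 3) (GenPetersen.Vertex.u 0)
          (GenPetersen.outerEdge n (i : ZMod n)) : ℤ) =
        if i ≤ 2 ∨ (n : ℤ) - 3 ≤ i then
          min i ((n : ℤ) - 1 - i)
        else
          min (⌈(i : ℚ) / 3⌉ + 2) (⌈((n : ℚ) - i - 1) / 3⌉ + 2)) ∧
      -- the distance from `u_0` to the spoke `u_i v_i`
      ((GenPetersen.distEdge (GenPetersen.petersen n 3) (GenPetersen.Vertex.u 0)
          (GenPetersen.spoke n (i : ZMod n)) : ℤ) =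
        if i ≤ 2 ∨ (n : ℤ) - 2 ≤ i then
          min i ((n : ℤ) - i)
        else
          min (GenPetersen.q i + GenPetersen.r i + 1)
            (GenPetersen.q n - GenPetersen.q i + GenPetersen.rDiff n i + 1)) ∧
      -- the distance from `u_0` to the inner edge `v_i v_{i+3}`
      ((GenPetersen.distEdge (GenPetersen.petersen n 3) (GenPetersen.Vertex.u 0)
          (GenPetersen.innerEdge n 3 (i : ZMod n)) : ℤ) =
        if i ≤ 1 ∨ i = (n : ℤ) - 1 then
          min (i + 1) ((n : ℤ) - i + 1)
        else
          min (GenPetersen.q i + GenPetersen.r i + 1)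
            (GenPetersen.q n - GenPetersen.q i + GenPetersen.rDiff n i)) ∧
      -- the distance from `v_0` to the outer edge `u_i u_{i+1}`
      ((GenPetersen.distEdge (GenPetersen.petersen n 3) (GenPetersen.Vertex.v 0)
          (GenPetersen.outerEdge n (i : ZMod n)) : ℤ) =
        if GenPetersen.r i = 0 ∨ (GenPetersen.r n = 0 ∧ GenPetersen.r i = 2) then
          min (GenPetersen.q i + ⌊(GenPetersen.r i : ℚ) / 2⌋ + 1)
            (GenPetersen.q n - GenPetersen.q i + ⌊(GenPetersen.r n : ℚ) / 2⌋
              - ⌊(GenPetersen.r i : ℚ) / 2⌋ + 1)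
        else
          min (GenPetersen.q i + 2) (GenPetersen.q n - GenPetersen.q i + 1)) ∧
      -- the distance from `v_0` to the spoke `u_i v_i`
      ((GenPetersen.distEdge (GenPetersen.petersen n 3) (GenPetersen.Vertex.v 0)
          (GenPetersen.spoke n (i : ZMod n)) : ℤ) =
        if GenPetersen.r i = GenPetersen.r n then
          if GenPetersen.r n = 0 then
            min (GenPetersen.q i) (GenPetersen.q n - GenPetersen.q i)
          else
            min (GenPetersen.q i + GenPetersen.r n + 1) (GenPetersen.q n - GenPetersen.q i)
        else if GenPetersen.r i = 0 then
          min (GenPetersen.q i) (GenPetersen.q n - GenPetersen.q i + GenPetersen.r n + 1)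
        else if GenPetersen.r i = 1 then
          min (GenPetersen.q i + 2) (GenPetersen.q n - GenPetersen.q i + 2)
        else
          min (GenPetersen.q i + 3) (GenPetersen.q n - GenPetersen.q i + GenPetersen.r n + 1)) ∧
      -- the distance from `v_0` to the inner edge `v_i v_{i+3}`
      ((GenPetersen.distEdge (GenPetersen.petersen n 3) (GenPetersen.Vertex.v 0)
          (GenPetersen.innerEdge n 3 (i : ZMod n)) : ℤ) =
        if i = (n : ℤ) - 1 then
          3
        else if GenPetersen.r i = GenPetersen.r n then
          if GenPetersen.r n = 0 then
            min (GenPetersen.q i) (GenPetersen.q n - GenPetersen.q i - 1)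
          else
            min (GenPetersen.q i + GenPetersen.r i + 2)
              (GenPetersen.q n - GenPetersen.q i + GenPetersen.r n - GenPetersen.r i - 1)
        else if GenPetersen.r i = 0 then
          min (GenPetersen.q i) (GenPetersen.q n - GenPetersen.q i + GenPetersen.r n + 1)
        else if GenPetersen.r i = 1 then
          min (GenPetersen.q i + 3) (GenPetersen.q n - GenPetersen.q i + 2)
        else
          min (GenPetersen.q i + 4)
            (GenPetersen.q n - GenPetersen.q i + GenPetersen.r n + 1)) := by
  have : NeZero n := ⟨by omega⟩
  obtain ⟨hconn, hu⟩ := GenPetersen.connected_and_dist_from_outer hn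
  have hv := GenPetersen.dist_from_inner hn
  refine ⟨hconn, fun i hi0 hin => ?_⟩
  lift i to ℕ using hi0
  have hi : i < n := by omega
  have e0 : (i : ZMod n).val = i := ZMod.val_cast_of_lt hi
  have e1 := GenPetersen.val_add_cases (n := n) (c := 1) (by omega) i
  have e3 := GenPetersen.val_add_cases (n := n) (c := 3) (by omega) i
  have l1 := ZMod.val_lt ((i : ZMod n) + ((1 : ℕ) : ZMod n))
  have l3 := ZMod.val_lt ((i : ZMod n) + ((3 : ℕ) : ZMod n))
  rw [e0] at e1 e3
  have hsub : (n : ℚ) - ((i : ℤ) : ℚ) - 1 = ((n - i - 1 : ℤ) : ℚ) := by push_cast; rfl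
  rw [hsub]
  simp only [GenPetersen.ceil_div_three, GenPetersen.floor_div_two]
  simp only [GenPetersen.distEdge,
    GenPetersen.outerEdge, GenPetersen.spoke, GenPetersen.innerEdge, Sym2.lift_mk, hu, hv,
    GenPetersen.aroundCycle, Int.cast_natCast, e0]
  rw [Nat.cast_one] at e1 l1
  generalize ((i : ZMod n) + 1).val = i1 at *
  generalize ((i : ZMod n) + ((3 : ℕ) : ZMod n)).val = i3 at *
  clear hu hv hconn e0 hsub this
  simp only [GenPetersen.q, GenPetersen.r, GenPetersen.rDiff, abs_eq_max_neg]
  -- Going one way, the edge is first met at index difference `i`, going the other way at `m`. Once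
  -- the residues of `i` and `m` modulo `3` are fixed, both sides are minima of linear expressions.
  refine ⟨?_, ?_, ?_, ?_, ?_, ?_⟩
  · rw [GenPetersen.min_bothWays_succ hi e1]
    simp only [GenPetersen.min_outerOuter_succ]
    obtain ⟨m, rfl⟩ : ∃ m, n = i + m + 1 := ⟨n - 1 - i, by omega⟩
    rw [show i + m + 1 - 1 - i = m by omega]
    clear e1 e3 l1 l3
    push_cast
    split_ifs <;> omega
  · unfold GenPetersen.bothWays
    rw [min_min_min_comm]
    simp only [GenPetersen.min_outerOuter_outerInner]
    obtain ⟨m, rfl⟩ : ∃ m, n = i + m := ⟨n - i, by omega⟩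
    rw [Nat.add_sub_cancel_left]
    clear e1 e3 l1 l3
    obtain ⟨c, rfl | rfl | rfl⟩ := GenPetersen.exists_eq_three_mul i <;>
      obtain ⟨d, rfl | rfl | rfl⟩ := GenPetersen.exists_eq_three_mul m <;>
      split_ifs <;> omega
  · rw [GenPetersen.min_bothWays_add_three hn hi e3 (by unfold GenPetersen.outerInner; omega)
      (by unfold GenPetersen.outerInner; omega)]
    clear e1 e3 l1 l3
    unfold GenPetersen.outerInner
    by_cases hle : i + 3 ≤ n
    · rw [if_pos hle]
      obtain ⟨m, rfl⟩ : ∃ m, n = i + m + 3 := ⟨n - 3 - i, by omega⟩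
      rw [show i + m + 3 - 3 - i = m by omega]
      obtain ⟨c, rfl | rfl | rfl⟩ := GenPetersen.exists_eq_three_mul i <;>
        obtain ⟨d, rfl | rfl | rfl⟩ := GenPetersen.exists_eq_three_mul m <;>
        split_ifs <;> omega
    · rw [if_neg hle]
      obtain rfl | rfl : n = i + 1 ∨ n = i + 2 := by omega
      all_goals
        obtain ⟨c, rfl | rfl | rfl⟩ := GenPetersen.exists_eq_three_mul i <;> split_ifs <;> omega
  · rw [GenPetersen.min_bothWays_succ hi e1]
    simp only [GenPetersen.min_outerInner_succ]
    obtain ⟨m, rfl⟩ : ∃ m, n = i + m + 1 := ⟨n - 1 - i, by omega⟩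
    rw [show i + m + 1 - 1 - i = m by omega]
    clear e1 e3 l1 l3
    obtain ⟨c, rfl | rfl | rfl⟩ := GenPetersen.exists_eq_three_mul i <;>
      obtain ⟨d, rfl | rfl | rfl⟩ := GenPetersen.exists_eq_three_mul m <;>
      split_ifs <;> omega
  · unfold GenPetersen.bothWays
    rw [min_min_min_comm]
    simp only [GenPetersen.min_outerInner_innerInner]
    obtain ⟨m, rfl⟩ : ∃ m, n = i + m := ⟨n - i, by omega⟩
    rw [Nat.add_sub_cancel_left]
    clear e1 e3 l1 l3
    obtain ⟨c, rfl | rfl | rfl⟩ := GenPetersen.exists_eq_three_mul i <;>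
      obtain ⟨d, rfl | rfl | rfl⟩ := GenPetersen.exists_eq_three_mul m <;>
      split_ifs <;> omega
  · rw [GenPetersen.min_bothWays_add_three hn hi e3 (by unfold GenPetersen.innerInner; omega)
      (by unfold GenPetersen.innerInner; omega)]
    clear e1 e3 l1 l3
    unfold GenPetersen.innerInner
    by_cases hle : i + 3 ≤ n
    · rw [if_pos hle]
      obtain ⟨m, rfl⟩ : ∃ m, n = i + m + 3 := ⟨n - 3 - i, by omega⟩
      rw [show i + m + 3 - 3 - i = m by omega]
      obtain ⟨c, rfl | rfl | rfl⟩ := GenPetersen.exists_eq_three_mul i <;>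
        obtain ⟨d, rfl | rfl | rfl⟩ := GenPetersen.exists_eq_three_mul m <;>
        split_ifs <;> omega
    · rw [if_neg hle]
      obtain rfl | rfl : n = i + 1 ∨ n = i + 2 := by omega
      all_goals
        obtain ⟨c, rfl | rfl | rfl⟩ := GenPetersen.exists_eq_three_mul i <;> split_ifs <;> omega
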